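/- **Setting.** Let $G=(\mathcal V\cup\mathcal J,E)$ be a finite bipartite graph with variable nodes $\mathcal V=\{v_1,\dots,v_N\}$ and local-code nodes $\mathcal J=\{C_1,\dots,C_J\}$, $\deg_G(C_j)=n_j$, in which the edges at each $C_j$ are labeled $1,\dots,n_j$; let $\overline{\mathcal C}^j\subseteq\mathbb F_2^{n_j}$ be a linear code of minimum distance $d_j$ for each $j$ ($d_j=\infty$ for the zero code), and let $d^*=\min_j d_j$. Write $x_{\mathcal V_j}$ for the restriction of $x\in\mathbb F_2^N$ to the neighbors of $C_j$ in the order of the labels, and $\mathcal C^j=\{x\in\mathbb F_2^N: x_{\mathcal V_j}\in\overline{\mathcal C}^j\}$. The Tanner code is $\mathcal C(G)=\bigcap_j\mathcal C^j$, and the generalized fundamental polytope is $\mathcal P=\bigcap_j\mathrm{conv}(\mathcal C^j)\subseteq\mathbb R^N$, where $\{0,1\}$-words are regarded as real vectors. Assume that no variable node has degree $1$ in $G$. **Trees.** The path-prefix tree $\mathcal T_r^{k}(G)$ has as vertices the backtrackless paths in $G$ of length at most $k$ that start at $r$ (the empty path is the root), a path being joined to each of its one-edge extensions; $\hat p\sim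 v$ means that the path $\hat p$ ends at $v$, and $\hat p$ is called a variable or a local-code node according to its end. An $i$-tree of height $k$ rooted at $r$ is a subtree of $\mathcal T_r^k(G)$ that contains the root, in which every variable node has the same degree as in $\mathcal T_r^k(G)$ and every local-code node has degree $i$. For $\omega=(\omega_1,\dots,\omega_h)\in\mathbb R_{\ge0}^h$ and an $i$-tree $\mathcal T$ of height $2h$ rooted at a variable node $r$, a variable node $\hat v\sim v$ of $\mathcal T$ other than the root $\hat r$ has weight $$\mathcal T^{(\omega)}(\hat v)=\frac{\omega_t}{\deg_G(v)}\prod_{\hat u}\frac1{\deg_{\mathcal T}(\hat u)-1},\qquad t=\Big\lceil\frac{d(\hat r,\hat v)}2\Big\rceil,$$ where $\hat u$ runs over the inner vertices of the path in $\mathcal T$ from $\hat r$ to $\hat v$. Its projection $\pi_G[\mathcal T^{(\omega)}]\in\mathbb R^N$ has $v$-th coordinate $\sum_{\hat v\sim v,\ \hat v\ne\hat r}\mathcal T^{(\omega)}(\hat v)$. Let $\mathcal B_i^{(\omega)}$ be the set of these projections, over all variable nodes $r$ and all $i$-trees of height $2h$ rooted at $r$. For $x\in\{0,1\}^N$ and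 a vector $f$ let $x\oplus f=(|x_v-f_v|)_v$. A codeword $x\in\mathcal C(G)$ is *$(h,\omega,i)$-locally optimal* for $\lambda\in\mathbb R^N$ if $\langle\lambda,x\oplus\beta\rangle>\langle\lambda,x\rangle$ for all $\beta\in\mathcal B_i^{(\omega)}$. It is the *unique optimal LP solution* given $\lambda$ if $x\in\mathcal P$ and $\langle\lambda,x\rangle<\langle\lambda,y\rangle$ for every $y\in\mathcal P$ with $y\neq x$. **Theorem 2.** Local optimality is sufficient for LP optimality: (a) There is a positive integer $M$, depending only on the graph and the local codes, such that for every $h$, every $\omega\in[0,\frac1M]^h\setminus\{0^h\}$, every $i$ with $2\le i\le d^*$ and $\mathcal B_i^{(\omega)}\subseteq[0,1]^N$, and every $\lambda\in\mathbb R^N$: if $x$ is an $(h,\omega,i)$-locally optimal codeword for $\lambda$, then $x$ is the unique optimal LP solution given $\lambda$. (b) For every $h$ there is a positive integer $M$, depending only on $h$, the graph and the local codes, such that for every $\omega\in[0,\frac1M]^h\setminus\{0^h\}$, every $i$ with $2\le i\le d^*$ and every $\lambda\in\mathbb R^N$: if $x$ is an $(h,\omega,i)$-locally optimal codeword for $\lambda$,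 then $x$ is the unique optimal LP solution given $\lambda$. -/

import Mathlib

open scoped Matrix

noncomputable section

namespace Tanner

/-! ### Path-prefix trees of a graph -/

section PathPrefix

variable {α : Type*}

/-- A list of vertices is a backtrackless path of `G`: consecutive vertices are adjacent, and no
edge is traversed back immediately after it has been traversed. -/
def IsBacktracklessPath (G : SimpleGraph α) (p : List α) : Prop :=
  p.IsChain G.Adj ∧ ∀ a b : α, ¬ [a, b, a] <:+: p

/-- The vertices of the path-prefix tree of `G` rooted at `r` with height `h`: the backtrackless
paths of length at most `h` that start at `r`. The path `r, u₁, …, u_k` is encoded by the list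
`[u₁, …, u_k]`, so that its length is the length of the list, the empty list is the root, and
prefixes of paths are prefixes of lists. -/
def pathPrefixVertices (G : SimpleGraph α) (r : α) (h : ℕ) : Set (List α) :=
  {p | IsBacktracklessPath G (r :: p) ∧ p.length ≤ h}

/-- The vertex of `G` at which the path encoded by `p` (starting at `r`) ends. -/
def endpoint (r : α) (p : List α) : α := p.getLastD r

/-- Edges of the path-prefix tree: one of the paths is a prefix of the other, shorter by one. -/
def TreeAdj (p q : List α) : Prop :=
  (p <+: q ∧ p.length + 1 = q.length) ∨ (q <+: p ∧ q.length + 1 = p.length)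

/-- `T` is the vertex set of a subtree of the path-prefix tree of `G` with root `r` and height `h`
that contains the root (connectedness means closure under prefixes). -/
def IsRootedSubtree (G : SimpleGraph α) (r : α) (h : ℕ) (T : Finset (List α)) : Prop :=
  (T : Set (List α)) ⊆ pathPrefixVertices G r h ∧ [] ∈ T ∧ ∀ q ∈ T, ∀ p, p <+: q → p ∈ T

open Classical in
/-- The degree of `p` in the subtree with vertex set `T`. -/
def treeDegree (T : Finset (List α)) (p : List α) : ℕ :=
  (T.filter (fun q => TreeAdj p q)).card

end PathPrefix

/-! ### Tanner codes -/

/-- The minimum distance of a binary linear code, with value `⊤` for the zero code. -/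
def minDist {n : ℕ} (C : Submodule (ZMod 2) (Fin n → ZMod 2)) : ℕ∞ :=
  ⨅ (c ∈ C) (c' ∈ C) (_ : c ≠ c'), (hammingDist c c' : ℕ∞)

/-- An edge-labeled Tanner graph with variable nodes `V` and local-code nodes `J`, together with a
binary linear local code for every local-code node. The edge labeled `k` at the local-code node `j`
leads to the variable node `nbr j k`; distinct labels lead to distinct variable nodes. -/
structure TannerCode (V J : Type*) where
  len : J → ℕ
  nbr : ∀ j, Fin (len j) ↪ V
  localCode : ∀ j, Submodule (ZMod 2) (Fin (len j) → ZMod 2)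

/-- The `0/1` vector in `ℝ^V` of a binary word. -/
def toReal {V : Type*} (x : V → ZMod 2) : V → ℝ := fun v => ((x v).val : ℝ)

/-- The relative point `x ⊕ f`, with coordinates `|x_v - f_v|`. -/
def relativePoint {V : Type*} (x f : V → ℝ) : V → ℝ := fun v => |x v - f v|

/-- `ω_t` for a vector `ω = (ω_1, …, ω_h)` (and `0` for `t` outside `1, …, h`). -/
def coord {h : ℕ} (ω : Fin h → ℝ) (t : ℕ) : ℝ :=
  if ht : 1 ≤ t ∧ t ≤ h then ω ⟨t - 1, by omega⟩ else 0

namespace TannerCode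

variable {V J : Type*} (C : TannerCode V J)

/-- The bipartite Tanner graph. -/
def graph : SimpleGraph (V ⊕ J) where
  Adj a b := (∃ j k, a = Sum.inl (C.nbr j k) ∧ b = Sum.inr j) ∨
    (∃ j k, a = Sum.inr j ∧ b = Sum.inl (C.nbr j k))
  symm := ⟨by
    rintro a b (⟨j, k, ha, hb⟩ | ⟨j, k, ha, hb⟩)
    · exact Or.inr ⟨j, k, hb, ha⟩
    · exact Or.inl ⟨j, k, hb, ha⟩⟩
  loopless := ⟨by
    rintro a (⟨j, k, ha, hb⟩ | ⟨j, k, ha, hb⟩) <;> simp [ha] at hb⟩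

/-- The degree of a variable node in the Tanner graph. -/
def varDegree (v : V) : ℕ := (C.graph.neighborSet (Sum.inl v)).ncard

/-- The smallest minimum distance `d*` among the local codes. -/
def minLocalDist : ℕ∞ := ⨅ j, minDist (C.localCode j)

/-- The extension of the local code at `j` to the block length of the Tanner code: all words whose
projection to the neighbors of `j`, in the order of the labels, is in the local code. -/
def extendedCode (j : J) : Set (V → ZMod 2) :=
  {x | (fun k => x (C.nbr j k)) ∈ C.localCode j}

/-- The codewords of the Tanner code. -/
def code : Set (V → ZMod 2) := ⋂ j, C.extendedCode j

/-- The generalized fundamental polytope. -/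
def polytope : Set (V → ℝ) := ⋂ j, convexHull ℝ (toReal '' C.extendedCode j)

/-- `T` is the vertex set of a `d`-tree of height `h` rooted at `r`: a subtree of the path-prefix
tree in which every variable node has full degree and every local-code node has degree `d`. -/
def IsDTree (r : V ⊕ J) (h d : ℕ) (T : Finset (List (V ⊕ J))) : Prop :=
  IsRootedSubtree C.graph r h T ∧
  (∀ p ∈ T, ∀ v : V, endpoint r p = Sum.inl v →
    ∀ q ∈ pathPrefixVertices C.graph r h, TreeAdj p q → q ∈ T) ∧
  (∀ p ∈ T, ∀ j : J, endpoint r p = Sum.inr j → treeDegree T p = d)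

/-- The `ω`-weight of a vertex `p ≠ []` of the subtree `T`, where `p` ends at the variable node `v`;
the lists `p.take k` with `1 ≤ k < p.length` are the inner vertices of the path in `T` from the root
to `p`, and `(p.length + 1) / 2` is the distance from the root, halved and rounded up. -/
def treeWeight {h : ℕ} (ω : Fin h → ℝ) (T : Finset (List (V ⊕ J))) (v : V)
    (p : List (V ⊕ J)) : ℝ :=
  coord ω ((p.length + 1) / 2) / (C.varDegree v : ℝ) *
    ∏ k ∈ Finset.Ico 1 p.length, 1 / ((treeDegree T (p.take k) : ℝ) - 1)

open Classical in
/-- The projection to the Tanner graph of the `ω`-weighted subtree `T` rooted at `r`. -/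
def projection {h : ℕ} (ω : Fin h → ℝ) (r : V ⊕ J) (T : Finset (List (V ⊕ J))) : V → ℝ :=
  fun v => ∑ p ∈ T.filter (fun p => p ≠ [] ∧ endpoint r p = Sum.inl v), C.treeWeight ω T v p

/-- The projections of the `ω`-weighted `i`-trees of height `2h` rooted at variable nodes. -/
def deviations {h : ℕ} (ω : Fin h → ℝ) (i : ℕ) : Set (V → ℝ) :=
  {β | ∃ (r : V) (T : Finset (List (V ⊕ J))),
    C.IsDTree (Sum.inl r) (2 * h) i T ∧ β = C.projection ω (Sum.inl r) T}

variable [Fintype V]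

/-- `x` is an `(h, ω, i)`-locally optimal codeword for `lam`. -/
def IsLocallyOptimal {h : ℕ} (ω : Fin h → ℝ) (i : ℕ) (lam : V → ℝ) (x : V → ZMod 2) : Prop :=
  x ∈ C.code ∧ ∀ β ∈ C.deviations ω i, lam ⬝ᵥ toReal x < lam ⬝ᵥ relativePoint (toReal x) β

/-- `y` is the unique optimal solution of LP decoding for `lam`. -/
def IsUniqueLPOptimum (lam : V → ℝ) (y : V → ℝ) : Prop :=
  y ∈ C.polytope ∧ ∀ z ∈ C.polytope, z ≠ y → lam ⬝ᵥ y < lam ⬝ᵥ z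

end TannerCode

end Tanner

end

namespace Tanner

/-! ### Trees of lists given by a branching rule -/

section Branching

variable {α : Type*}

/-! Fix a locally optimal `x` and a point `z ≠ x` of the polytope. Flip the signs of `lam` on the
support of `x` to get `lam'`, and put `f = |x - z|`. On the unit cube `|x - z|` is affine in `z`, so
`⟨lam, z⟩ - ⟨lam, x⟩ = ⟨lam', f⟩`, and local optimality says `⟨lam', β⟩ > 0` for every deviation `β`
in the cube. It remains to show `⟨lam', f⟩ > 0`.

For each root `r` in the support of `f`, let `β_r` come from the cheapest `i`-tree with variable
nodes in that support, built by dynamic programming. The heart is `∑ f_r ⟨lam', β_r⟩ ≤ (∑ ω_t)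
⟨lam', f⟩`: its left side is positive, hence so is `⟨lam', f⟩`.

The inequality is proved level by level. Around one local code, `f` is a convex combination of
indicators of difference sets between codewords, each empty or with at least `i` elements. Within
such a set, the average over the `i - 1` cheapest alternatives to `u` is at most the average over
all elements other than `u`; summing over `u` gives back the total cost of the set
(`sum_mul_average_pick_le`, `codeCost_le_of_mem_convexHull`). At a variable node the factor `1 /
(deg - 1)` cancels the number of possible parents of each child (`sum_varCost_le`). No sign
condition on the costs is needed.

Confining the trees to the support of `f` matters: a zero local code may have fewer than `i`
neighbors, but `f` vanishes on them. -/

theorem prefix_length_succ {p q : List α} (h : p <+: q) (hl : p.length + 1 = q.length) :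
    ∃ a, q = p ++ [a] := by
  obtain ⟨t, rfl⟩ := h
  have : t.length = 1 := by simp at hl; omega
  obtain ⟨a, rfl⟩ := List.length_eq_one_iff.1 this
  exact ⟨a, rfl⟩

variable (K : List α → Finset α)

/-- The product of the reciprocals of the numbers of children over the inner vertices of the path
from the root to `p`. -/
noncomputable def branchWeight (p : List α) : ℝ :=
  ∏ k ∈ Finset.Ico 1 p.length, ((K (p.take k)).card : ℝ)⁻¹

variable {K}

theorem branchWeight_append {p : List α} (hp : p ≠ []) (a : α) :
    branchWeight K (p ++ [a]) = branchWeight K p * ((K p).card : ℝ)⁻¹ := by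
  have hl : 1 ≤ p.length := List.length_pos_iff.2 hp
  rw [branchWeight, List.length_append, List.length_singleton, Finset.prod_Ico_succ_top hl,
    branchWeight]
  congr 1
  · refine Finset.prod_congr rfl fun k hk => ?_
    rw [List.take_append_of_le_length (Finset.mem_Ico.1 hk).2.le]
  · rw [List.take_append_of_le_length le_rfl, List.take_length]

theorem branchWeight_singleton (a : α) : branchWeight K [a] = 1 := by simp [branchWeight]

variable [DecidableEq α] (K)

/-- The lists of length `n` all of whose entries are allowed by the branching rule `K`. -/
def level : ℕ → Finset (List α)
  | 0 => {[]}
  | n + 1 => (level n).biUnion fun p => (K p).image fun a => p ++ [a]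

/-- The tree of height `H` in which the children of `p` are the lists `p ++ [a]` with `a ∈ K p`. -/
def branchTree (H : ℕ) : Finset (List α) := (Finset.range (H + 1)).biUnion (level K)

variable {K}

theorem length_of_mem_level {n : ℕ} {p : List α} (hp : p ∈ level K n) : p.length = n := by
  induction n generalizing p with
  | zero => simpa [level] using hp
  | succ n ih =>
    simp only [level, Finset.mem_biUnion, Finset.mem_image] at hp
    obtain ⟨q, hq, a, -, rfl⟩ := hp
    simp [ih hq]

theorem append_mem_level {n : ℕ} {p : List α} {a : α} :
    p ++ [a] ∈ level K (n + 1) ↔ p ∈ level K n ∧ a ∈ K p := by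
  simp only [level, Finset.mem_biUnion, Finset.mem_image]
  constructor
  · rintro ⟨q, hq, b, hb, h⟩
    obtain ⟨rfl, h'⟩ := List.append_inj' h rfl
    cases h'
    exact ⟨hq, hb⟩
  · rintro ⟨hp, ha⟩
    exact ⟨p, hp, a, ha, rfl⟩

theorem exists_of_mem_level_succ {n : ℕ} {p : List α} (hp : p ∈ level K (n + 1)) :
    ∃ q ∈ level K n, ∃ a ∈ K q, p = q ++ [a] := by
  simp only [level, Finset.mem_biUnion, Finset.mem_image] at hp
  obtain ⟨q, hq, a, ha, rfl⟩ := hp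
  exact ⟨q, hq, a, ha, rfl⟩

theorem mem_branchTree {H : ℕ} {p : List α} :
    p ∈ branchTree K H ↔ p.length ≤ H ∧ p ∈ level K p.length := by
  simp only [branchTree, Finset.mem_biUnion, Finset.mem_range]
  constructor
  · rintro ⟨n, hn, hp⟩
    have := length_of_mem_level hp
    subst this
    exact ⟨by omega, hp⟩
  · rintro ⟨h, hp⟩
    exact ⟨_, by omega, hp⟩

theorem append_mem_branchTree {H : ℕ} {p : List α} {a : α} :
    p ++ [a] ∈ branchTree K H ↔ p.length < H ∧ p ∈ branchTree K H ∧ a ∈ K p := by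
  simp only [mem_branchTree, List.length_append, List.length_singleton, append_mem_level]
  constructor
  · rintro ⟨h, hp, ha⟩
    exact ⟨by omega, ⟨by omega, hp⟩, ha⟩
  · rintro ⟨h, ⟨-, hp⟩, ha⟩
    exact ⟨by omega, hp, ha⟩

theorem nil_mem_branchTree {H : ℕ} : [] ∈ branchTree K H := by
  simp [mem_branchTree, level]

theorem prefix_mem_branchTree {H : ℕ} {p q : List α} (hq : q ∈ branchTree K H) (hpq : p <+: q) :
    p ∈ branchTree K H := by
  induction q using List.reverseRecOn with
  | nil => rw [List.prefix_nil.1 hpq]; exact hq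
  | append_singleton q a ih =>
    rcases List.prefix_concat_iff.1 hpq with rfl | h
    · exact hq
    · exact ih (append_mem_branchTree.1 hq).2.1 h

/-- The parent accounts for the extra one, so the root and the last level are excluded. Thus the
factor `1 / (degree - 1)` in the weights is one over the number of children. -/
theorem treeDegree_branchTree {H : ℕ} {p : List α} (hp : p ∈ branchTree K H) (hne : p ≠ [])
    (hl : p.length < H) : treeDegree (branchTree K H) p = (K p).card + 1 := by
  obtain ⟨q, b, rfl⟩ : ∃ q b, p = q ++ [b] := ⟨_, _, (List.dropLast_append_getLast hne).symm⟩
  have hq := (append_mem_branchTree.1 hp).2.1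
  have key : ∀ s, (s ∈ branchTree K H ∧ TreeAdj (q ++ [b]) s) ↔
      s ∈ insert q ((K (q ++ [b])).image fun a => q ++ [b] ++ [a]) := by
    intro s
    simp only [Finset.mem_insert, Finset.mem_image]
    constructor
    · rintro ⟨hs, ⟨h, hl'⟩ | ⟨h, hl'⟩⟩
      · obtain ⟨a, rfl⟩ := prefix_length_succ h hl'
        exact Or.inr ⟨a, (append_mem_branchTree.1 hs).2.2, rfl⟩
      · obtain ⟨a, ha⟩ := prefix_length_succ h hl'
        exact Or.inl (List.append_inj' ha rfl).1.symm
    · rintro (rfl | ⟨a, ha, rfl⟩)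
      · exact ⟨hq, Or.inr ⟨List.prefix_append _ _, by simp⟩⟩
      · exact ⟨append_mem_branchTree.2 ⟨hl, hp, ha⟩, Or.inl ⟨List.prefix_append _ _, by simp⟩⟩
  have hcard : (insert q ((K (q ++ [b])).image fun a => q ++ [b] ++ [a])).card =
      (K (q ++ [b])).card + 1 := by
    rw [Finset.card_insert_of_notMem, Finset.card_image_of_injective]
    · intro a a' h
      simpa using h
    · simp
  rw [← hcard, treeDegree]
  congr 1
  ext s
  rw [← key s]
  simp

theorem sum_level_succ (F : List α → ℝ) (n : ℕ) :
    ∑ p ∈ level K (n + 1), F p = ∑ p ∈ level K n, ∑ a ∈ K p, F (p ++ [a]) := by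
  rw [level, Finset.sum_biUnion]
  · refine Finset.sum_congr rfl fun p _ => ?_
    rw [Finset.sum_image]
    intro a _ a' _ h
    simpa using h
  · intro p _ q _ hpq
    rw [Function.onFun, Finset.disjoint_left]
    intro s hs hs'
    simp only [Finset.mem_image] at hs hs'
    obtain ⟨a, -, rfl⟩ := hs
    obtain ⟨a', -, h⟩ := hs'
    exact hpq (List.append_inj' h rfl).1.symm

/-- The total weighted cost of the tree is computed by a cost-to-go function `U`. -/
theorem sum_branchTree {H : ℕ} (hH : 1 ≤ H) (cost U : List α → ℝ)
    (hstep : ∀ n, 1 ≤ n → n < H → ∀ p ∈ level K n,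
      U p = cost p + ((K p).card : ℝ)⁻¹ * ∑ a ∈ K p, U (p ++ [a]))
    (hlast : ∀ p ∈ level K H, U p = cost p) :
    ∑ p ∈ (branchTree K H).filter (fun p => p ≠ []), cost p * branchWeight K p =
      ∑ a ∈ K [], U [a] := by
  have h1 : ∑ p ∈ (branchTree K H).filter (fun p => p ≠ []), cost p * branchWeight K p =
      ∑ n ∈ Finset.Ico 1 (H + 1), ∑ p ∈ level K n, cost p * branchWeight K p := by
    rw [← Finset.sum_biUnion]
    · refine Finset.sum_congr ?_ fun _ _ => rfl
      ext p
      simp only [Finset.mem_filter, mem_branchTree, Finset.mem_biUnion, Finset.mem_Ico]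
      constructor
      · rintro ⟨⟨h, hp⟩, hne⟩
        exact ⟨_, ⟨List.length_pos_iff.2 hne, by omega⟩, hp⟩
      · rintro ⟨n, hn, hp⟩
        have := length_of_mem_level hp
        subst this
        exact ⟨⟨by omega, hp⟩, List.length_pos_iff.1 (by omega)⟩
    · intro m _ n _ hmn
      rw [Function.onFun, Finset.disjoint_left]
      intro p hp hp'
      exact hmn ((length_of_mem_level hp).symm.trans (length_of_mem_level hp'))
  -- Invariant: the cost paid above level `m` plus the cost-to-go at level `m` does not depend on
  -- `m`.
  have h2 : ∀ m, 1 ≤ m → m ≤ H →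
      ∑ n ∈ Finset.Ico 1 m, ∑ p ∈ level K n, cost p * branchWeight K p +
        ∑ p ∈ level K m, U p * branchWeight K p = ∑ a ∈ K [], U [a] := by
    intro m hm
    induction m, hm using Nat.le_induction with
    | base =>
      intro _
      rw [sum_level_succ]
      simp [level, branchWeight_singleton]
    | succ m hm ih =>
      intro hmH
      rw [← ih (by omega), Finset.sum_Ico_succ_top hm, add_assoc, sum_level_succ,
        ← Finset.sum_add_distrib]
      congr 1
      refine Finset.sum_congr rfl fun p hp => ?_
      have hne : p ≠ [] := List.length_pos_iff.1 (by rw [length_of_mem_level hp]; omega)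
      rw [hstep m hm (by omega) p hp]
      simp only [branchWeight_append hne]
      rw [← Finset.sum_mul]
      ring
  rw [h1, ← h2 H hH le_rfl, Finset.sum_Ico_succ_top hH]
  congr 1
  exact Finset.sum_congr rfl fun p hp => by rw [hlast p hp]

end Branching

/-! ### Backtrackless paths -/

section Backtrackless

variable {α : Type*} {G : SimpleGraph α}

/-- A new backtrack can only occur in the last three vertices. -/
theorem isBacktracklessPath_append {l : List α} {x y a : α}
    (h : IsBacktracklessPath G (l ++ [y, x])) (hadj : G.Adj x a) (hne : a ≠ y) :
    IsBacktracklessPath G (l ++ [y, x] ++ [a]) := by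
  refine ⟨?_, ?_⟩
  · rw [List.isChain_append]
    refine ⟨h.1, List.isChain_singleton _, ?_⟩
    simpa using hadj
  · intro c b hcb
    rcases List.infix_concat_iff.1 hcb with hs | hs
    · obtain ⟨t, ht⟩ := hs
      have : t ++ [c, b, c] = l ++ [y, x, a] := by simpa using ht
      have := (List.append_inj' this rfl).2
      simp only [List.cons.injEq, and_true] at this
      exact hne (this.2.2.symm.trans this.1)
    · exact h.2 c b hs

theorem adj_of_isBacktracklessPath {l : List α} {x a : α}
    (h : IsBacktracklessPath G (l ++ [x] ++ [a])) : G.Adj x a := by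
  have := (List.isChain_append.1 h.1).2.2
  simpa using this

theorem ne_of_isBacktracklessPath {l : List α} {x y a : α}
    (h : IsBacktracklessPath G (l ++ [y, x] ++ [a])) : a ≠ y := by
  rintro rfl
  exact h.2 a x ⟨l, [], by simp⟩

theorem isBacktracklessPath_pair {x a : α} (h : G.Adj x a) : IsBacktracklessPath G [x, a] := by
  refine ⟨by simpa using h, fun c b hcb => ?_⟩
  have := hcb.length_le
  simp at this

theorem isBacktracklessPath_singleton (x : α) : IsBacktracklessPath G [x] := by
  refine ⟨by simp, fun c b hcb => ?_⟩
  have := hcb.length_le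
  simp at this

theorem endpoint_eq {r x y : α} {p l : List α} (h : r :: p = l ++ [y, x]) :
    endpoint r p = x := by
  rcases List.eq_nil_or_concat p with rfl | ⟨q, b, rfl⟩
  · have := congrArg List.length h
    simp at this
  · have h' : (r :: q) ++ [b] = (l ++ [y]) ++ [x] := by simpa using h
    have := (List.append_inj' h' rfl).2
    simpa [endpoint] using this

end Backtrackless

/-! ### Cheapest subsets -/

section Pick

variable {ι : Type*}

open Classical in
/-- A set of at least `m` numbers has `m` elements whose average is at most the total average. -/
theorem exists_subset_card_eq_average_le (c : ι → ℝ) (m : ℕ) (D : Finset ι) (hm : m ≤ D.card) :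
    ∃ S ⊆ D, S.card = m ∧ (D.card : ℝ) * ∑ x ∈ S, c x ≤ m * ∑ x ∈ D, c x := by
  obtain ⟨k, hk⟩ : ∃ k, D.card = m + k := ⟨D.card - m, by omega⟩
  induction k generalizing D with
  | zero => exact ⟨D, subset_rfl, by omega, by rw [hk]; simp⟩
  | succ k ih =>
    have hne : D.Nonempty := Finset.card_pos.1 (by omega)
    obtain ⟨a, ha, hmax⟩ := D.exists_max_image c hne
    -- Dropping a most expensive element does not raise the average.
    have hcard : (D.erase a).card = m + k := by rw [Finset.card_erase_of_mem ha]; omega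
    obtain ⟨S, hS, hSc, hle⟩ := ih (D.erase a) (by omega) hcard
    refine ⟨S, hS.trans (D.erase_subset a), hSc, ?_⟩
    have hsum := Finset.add_sum_erase D c ha
    have hb : ∑ x ∈ D.erase a, c x ≤ (m + k : ℝ) * c a := by
      have := Finset.sum_le_card_nsmul (D.erase a) c (c a)
        fun x hx => hmax x (Finset.mem_of_mem_erase hx)
      rw [hcard, nsmul_eq_mul] at this
      exact_mod_cast this
    rw [hcard] at hle
    rw [hk, ← hsum]
    push_cast at hle ⊢
    rcases Nat.eq_zero_or_pos (m + k) with h0 | hpos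
    · have hm0 : m = 0 := by omega
      have : S = ∅ := Finset.card_eq_zero.1 (by omega)
      simp [this, hm0]
    · have hpos' : (0 : ℝ) < m + k := by exact_mod_cast hpos
      have hm0 : (0 : ℝ) ≤ m := Nat.cast_nonneg m
      refine le_of_mul_le_mul_left ?_ hpos'
      nlinarith [mul_le_mul_of_nonneg_left hb hm0,
        mul_le_mul_of_nonneg_left hle (by linarith : (0 : ℝ) ≤ m + k + 1)]

theorem exists_cheapest_subset (A : Finset ι) (m : ℕ) (c : ι → ℝ) :
    ∃ S ⊆ A, m ≤ A.card →
      S.card = m ∧ ∀ S' ⊆ A, S'.card = m → ∑ x ∈ S, c x ≤ ∑ x ∈ S', c x := by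
  by_cases h : m ≤ A.card
  · obtain ⟨S, hS, hmin⟩ := (A.powersetCard m).exists_min_image (fun S => ∑ x ∈ S, c x)
      (Finset.powersetCard_nonempty.2 h)
    rw [Finset.mem_powersetCard] at hS
    exact ⟨S, hS.1, fun _ => ⟨hS.2, fun S' h1 h2 =>
      hmin S' (Finset.mem_powersetCard.2 ⟨h1, h2⟩)⟩⟩
  · exact ⟨∅, Finset.empty_subset _, fun h' => absurd h' h⟩

/-- A cheapest subset of `A` with `m` elements. -/
noncomputable def pick (A : Finset ι) (m : ℕ) (c : ι → ℝ) : Finset ι :=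
  (exists_cheapest_subset A m c).choose

theorem pick_subset (A : Finset ι) (m : ℕ) (c : ι → ℝ) : pick A m c ⊆ A :=
  (exists_cheapest_subset A m c).choose_spec.1

theorem card_pick {A : Finset ι} {m : ℕ} (c : ι → ℝ) (h : m ≤ A.card) : (pick A m c).card = m :=
  ((exists_cheapest_subset A m c).choose_spec.2 h).1

theorem sum_pick_le {A S : Finset ι} {m : ℕ} (c : ι → ℝ) (hS : S ⊆ A) (hm : S.card = m) :
    ∑ x ∈ pick A m c, c x ≤ ∑ x ∈ S, c x :=
  ((exists_cheapest_subset A m c).choose_spec.2 (hm ▸ Finset.card_le_card hS)).2 S hS hm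

/-- The minimizer over `A` beats the cheap `m`-subset of `D`. The choice does not depend on `D`, so
one selection serves all the sets in a convex combination at once. -/
theorem average_pick_le {A D : Finset ι} {m : ℕ} (c : ι → ℝ) (hD : D ⊆ A) (hm : 0 < m)
    (hmD : m ≤ D.card) :
    (m : ℝ)⁻¹ * ∑ x ∈ pick A m c, c x ≤ (D.card : ℝ)⁻¹ * ∑ x ∈ D, c x := by
  obtain ⟨S, hS, hSc, hle⟩ := exists_subset_card_eq_average_le c m D hmD
  have h1 := sum_pick_le c (hS.trans hD) hSc
  have hm' : (0 : ℝ) < m := by exact_mod_cast hm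
  have hD' : (0 : ℝ) < D.card := by exact_mod_cast hm.trans_le hmD
  rw [inv_mul_le_iff₀ hm', ← mul_assoc, mul_comm (m : ℝ), mul_assoc, le_inv_mul_iff₀ hD']
  exact (mul_le_mul_of_nonneg_left h1 hD'.le).trans hle

open Classical in
/-- If `f` is on `N` a nonnegative combination of indicators of sets that are empty or have more
than `m` elements, then passing from a vertex to a cheapest `m`-subset of the other vertices does
not increase the `f`-weighted cost. -/
theorem sum_mul_average_pick_le {κ : Type*} [Fintype κ] {N s : Finset ι} {m : ℕ} (hm : 0 < m)
    (w : κ → ℝ) (b : κ → Finset ι) (f : ι → ℝ) (hw : ∀ k, 0 ≤ w k) (hb : ∀ k, b k ⊆ N)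
    (hbs : ∀ k, w k ≠ 0 → b k ⊆ s) (hcard : ∀ k, b k = ∅ ∨ m + 1 ≤ (b k).card)
    (hf : ∀ v ∈ N, f v = ∑ k, if v ∈ b k then w k else 0) (c : ι → ℝ) :
    ∑ u ∈ N, f u * ((m : ℝ)⁻¹ * ∑ x ∈ pick ((N ∩ s).erase u) m c, c x) ≤
      ∑ u ∈ N, f u * c u := by
  have expand : ∀ g : ι → ℝ, ∑ u ∈ N, f u * g u = ∑ k, w k * ∑ u ∈ b k, g u := by
    intro g
    calc ∑ u ∈ N, f u * g u = ∑ u ∈ N, ∑ k, if u ∈ b k then w k * g u else 0 := by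
          refine Finset.sum_congr rfl fun u hu => ?_
          rw [hf u hu, Finset.sum_mul]
          exact Finset.sum_congr rfl fun k _ => by split_ifs <;> simp
      _ = ∑ k, ∑ u ∈ N, if u ∈ b k then w k * g u else 0 := Finset.sum_comm
      _ = ∑ k, w k * ∑ u ∈ b k, g u := by
          refine Finset.sum_congr rfl fun k _ => ?_
          rw [← Finset.sum_filter, Finset.filter_mem_eq_inter,
            Finset.inter_eq_right.2 (hb k), Finset.mul_sum]
  rw [expand, expand]
  refine Finset.sum_le_sum fun k _ => ?_
  by_cases hk : w k = 0
  · simp [hk]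
  refine mul_le_mul_of_nonneg_left ?_ (hw k)
  rcases hcard k with h0 | hcard
  · simp [h0]
  -- Sets of weight zero may leave `s`; they were discarded above.
  have hsub : b k ⊆ N ∩ s := Finset.subset_inter (hb k) (hbs k hk)
  have hpos : (0 : ℝ) < ((b k).card : ℝ) - 1 := by
    have : (2 : ℝ) ≤ (b k).card := by exact_mod_cast (by omega : 2 ≤ (b k).card)
    linarith
  calc ∑ u ∈ b k, ((m : ℝ)⁻¹ * ∑ x ∈ pick ((N ∩ s).erase u) m c, c x)
      ≤ ∑ u ∈ b k, (((b k).card : ℝ) - 1)⁻¹ * (∑ x ∈ b k, c x - c u) := by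
        refine Finset.sum_le_sum fun u hu => ?_
        have hc : ((b k).erase u).card = (b k).card - 1 := Finset.card_erase_of_mem hu
        have := average_pick_le c (Finset.erase_subset_erase u hsub) hm (by omega : m ≤ _)
        rw [hc, Nat.cast_sub (by omega), Nat.cast_one] at this
        rwa [← Finset.add_sum_erase (b k) c hu, add_sub_cancel_left]
    -- Each element of `b k` is an alternative to the `|b k| - 1` others, which cancels the
    -- normalization.
    _ = ∑ u ∈ b k, c u := by
        rw [← Finset.mul_sum, Finset.sum_sub_distrib, Finset.sum_const, nsmul_eq_mul]
        field_simp

end Pick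

namespace TannerCode

variable {V J : Type*} (C : TannerCode V J)

/-! ### Neighbors in the Tanner graph -/

/-- The neighbors of a local-code node. -/
def codeNbrs (j : J) : Finset V := Finset.univ.map (C.nbr j)

open Classical in
/-- The neighbors of a variable node. -/
noncomputable def varNbrs [Fintype J] (v : V) : Finset J := {j | v ∈ C.codeNbrs j}

variable {C}

@[simp] theorem graph_adj_inl_inr {v : V} {j : J} :
    C.graph.Adj (Sum.inl v) (Sum.inr j) ↔ v ∈ C.codeNbrs j := by
  simp only [graph, codeNbrs, Finset.mem_map, Finset.mem_univ, true_and]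
  constructor
  · rintro (⟨j', k, h1, h2⟩ | ⟨j', k, h1, h2⟩)
    · cases h2
      exact ⟨k, (Sum.inl.inj h1).symm⟩
    · cases h1
  · rintro ⟨k, rfl⟩
    exact Or.inl ⟨j, k, rfl, rfl⟩

@[simp] theorem graph_adj_inr_inl {v : V} {j : J} :
    C.graph.Adj (Sum.inr j) (Sum.inl v) ↔ v ∈ C.codeNbrs j := by
  rw [SimpleGraph.adj_comm, graph_adj_inl_inr]

theorem exists_of_graph_adj_inl {v : V} {a : V ⊕ J} (h : C.graph.Adj (Sum.inl v) a) :
    ∃ j, a = Sum.inr j ∧ v ∈ C.codeNbrs j := by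
  rcases a with u | j
  · rcases h with ⟨j', k, h1, h2⟩ | ⟨j', k, h1, h2⟩
    · cases h2
    · cases h1
  · exact ⟨j, rfl, graph_adj_inl_inr.1 h⟩

variable [Fintype J]

@[simp] theorem mem_varNbrs {v : V} {j : J} : j ∈ C.varNbrs v ↔ v ∈ C.codeNbrs j := by
  simp [varNbrs]

theorem varDegree_eq_card (v : V) : C.varDegree v = (C.varNbrs v).card := by
  have : C.graph.neighborSet (Sum.inl v) =
      (((C.varNbrs v).map Function.Embedding.inr : Finset (V ⊕ J)) : Set (V ⊕ J)) := by
    ext a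
    simp only [SimpleGraph.mem_neighborSet, Finset.coe_map, Set.mem_image, Finset.mem_coe,
      mem_varNbrs, Function.Embedding.inr_apply]
    constructor
    · intro h
      obtain ⟨j, rfl, hj⟩ := exists_of_graph_adj_inl h
      exact ⟨j, hj, rfl⟩
    · rintro ⟨j, hj, rfl⟩
      exact graph_adj_inl_inr.2 hj
  rw [varDegree, this, Set.ncard_coe_finset, Finset.card_map]

/-! ### Trees with prescribed children of the local-code nodes -/

open Classical in
variable (C) in
/-- The branching rule in which a variable node has all its other neighbors as children, and the
children of a local-code node `j` at depth `n` reached from `v` are given by `S n v j`. -/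
noncomputable def children (S : ℕ → V → J → Finset V) (r : V) (p : List (V ⊕ J)) :
    Finset (V ⊕ J) :=
  match (Sum.inl r :: p).reverse with
  | [Sum.inl v] => (C.varNbrs v).map Function.Embedding.inr
  | Sum.inl v :: Sum.inr j :: _ => ((C.varNbrs v).erase j).map Function.Embedding.inr
  | Sum.inr j :: Sum.inl v :: _ => (S p.length v j).map Function.Embedding.inl
  | _ => ∅

variable {S : ℕ → V → J → Finset V} {r : V} {p l : List (V ⊕ J)}

theorem children_nil :
    C.children S r [] = (C.varNbrs r).map Function.Embedding.inr := by
  simp [children]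

open Classical in
theorem children_var {j : J} {u : V} (h : Sum.inl r :: p = l ++ [Sum.inr j, Sum.inl u]) :
    C.children S r p = ((C.varNbrs u).erase j).map Function.Embedding.inr := by
  simp [children, h]

theorem children_code {j : J} {v : V} (h : Sum.inl r :: p = l ++ [Sum.inl v, Sum.inr j]) :
    C.children S r p = (S p.length v j).map Function.Embedding.inl := by
  simp [children, h]

open Classical in
-- The branching rule reads only the last two vertices of the path, so the induction carries them
-- along. The parity of the depth tells the two kinds of nodes apart.
theorem mem_level_children {s : Finset V}
    (hS : ∀ n v j, S n v j ⊆ (C.codeNbrs j ∩ s).erase v) (hr : r ∈ s) {n : ℕ}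
    (hp : p ∈ level (C.children S r) n) :
    IsBacktracklessPath C.graph (Sum.inl r :: p) ∧
      ((p = [] ∧ n = 0) ∨
        (∃ l j u, Sum.inl r :: p = l ++ [Sum.inr j, Sum.inl u] ∧ u ∈ C.codeNbrs j ∧ u ∈ s ∧
          Even n ∧ n ≠ 0) ∨
        (∃ l v j, Sum.inl r :: p = l ++ [Sum.inl v, Sum.inr j] ∧ v ∈ C.codeNbrs j ∧ v ∈ s ∧
          Odd n)) := by
  induction n generalizing p with
  | zero =>
    have : p = [] := by simpa [level] using hp
    subst this
    exact ⟨isBacktracklessPath_singleton _, Or.inl ⟨rfl, rfl⟩⟩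
  | succ n ih =>
    obtain ⟨q, hq, a, ha, rfl⟩ := exists_of_mem_level_succ hp
    obtain ⟨hpath, ⟨rfl, rfl⟩ | ⟨l, j, u, hl, hu, hus, hn, -⟩ | ⟨l, v, j, hl, hv, hvs, hn⟩⟩ := ih hq
    · rw [children_nil, Finset.mem_map] at ha
      obtain ⟨j, hj, rfl⟩ := ha
      rw [mem_varNbrs] at hj
      exact ⟨isBacktracklessPath_pair (graph_adj_inl_inr.2 hj),
        Or.inr (Or.inr ⟨[], r, j, rfl, hj, hr, odd_one⟩)⟩
    · rw [children_var hl, Finset.mem_map] at ha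
      obtain ⟨j', hj, rfl⟩ := ha
      rw [Finset.mem_erase, mem_varNbrs] at hj
      rw [hl] at hpath
      rw [← List.cons_append, hl]
      exact ⟨isBacktracklessPath_append hpath (graph_adj_inl_inr.2 hj.2)
        fun h => hj.1 (Sum.inr.inj h),
        Or.inr (Or.inr ⟨l ++ [Sum.inr j], u, j', by simp, hj.2, hus, hn.add_one⟩)⟩
    · rw [children_code hl, Finset.mem_map] at ha
      obtain ⟨u, hu, rfl⟩ := ha
      have hu' := hS _ _ _ hu
      rw [Finset.mem_erase, Finset.mem_inter] at hu'
      rw [hl] at hpath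
      rw [← List.cons_append, hl]
      exact ⟨isBacktracklessPath_append hpath (graph_adj_inr_inl.2 hu'.2.1)
        fun h => hu'.1 (Sum.inl.inj h),
        Or.inr (Or.inl ⟨l ++ [Sum.inl v], j, u, by simp, hu'.2.1, hu'.2.2, hn.add_one, by omega⟩)⟩

open Classical in
theorem isDTree_branchTree {s : Finset V} {h i : ℕ}
    (hS : ∀ n v j, S n v j ⊆ (C.codeNbrs j ∩ s).erase v)
    (hcard : ∀ n, ∀ v ∈ s, ∀ j, v ∈ C.codeNbrs j → (S n v j).card + 1 = i) (hr : r ∈ s) :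
    C.IsDTree (Sum.inl r) (2 * h) i (branchTree (C.children S r) (2 * h)) := by
  refine ⟨⟨?_, nil_mem_branchTree, fun q hq p hpq => prefix_mem_branchTree hq hpq⟩, ?_, ?_⟩
  · intro p hp
    have hp := mem_branchTree.1 hp
    exact ⟨(mem_level_children hS hr hp.2).1, hp.1⟩
  · rintro p hp v hv q ⟨hq, hql⟩ (⟨h1, h2⟩ | ⟨h1, -⟩)
    · obtain ⟨a, rfl⟩ := prefix_length_succ h1 h2
      refine append_mem_branchTree.2 ⟨by omega, hp, ?_⟩
      rw [← List.cons_append] at hq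
      obtain ⟨-, ⟨rfl, -⟩ | ⟨l, j, u, hl, hu, -⟩ | ⟨l, u, j, hl, -⟩⟩ :=
        mem_level_children hS hr (mem_branchTree.1 hp).2
      · obtain ⟨j, rfl, hj⟩ := exists_of_graph_adj_inl (adj_of_isBacktracklessPath (l := []) hq)
        rw [children_nil, Finset.mem_map]
        exact ⟨j, mem_varNbrs.2 hj, rfl⟩
      · rw [hl] at hq
        have hadj : C.graph.Adj (Sum.inl u) a :=
          adj_of_isBacktracklessPath (l := l ++ [Sum.inr j]) (by simpa using hq)
        obtain ⟨j', rfl, hj⟩ := exists_of_graph_adj_inl hadj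
        rw [children_var hl, Finset.mem_map]
        refine ⟨j', Finset.mem_erase.2 ⟨?_, mem_varNbrs.2 hj⟩, rfl⟩
        rintro rfl
        exact ne_of_isBacktracklessPath hq rfl
      · rw [endpoint_eq hl] at hv
        cases hv
    · exact prefix_mem_branchTree hp h1
  · intro p hp j hj
    have hp' := mem_branchTree.1 hp
    obtain ⟨-, ⟨rfl, -⟩ | ⟨l, j, u, hl, hu, -⟩ | ⟨l, u, j', hl, hu, hus, hodd⟩⟩ :=
      mem_level_children hS hr hp'.2
    · cases hj
    · rw [endpoint_eq hl] at hj
      cases hj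
    · have hne : p ≠ [] := by
        rintro rfl
        simp at hodd
      -- Local-code nodes have odd depth and the height is even, so none of them is cut off as a
      -- leaf.
      have hlt : p.length < 2 * h := by
        obtain ⟨t, ht⟩ := hodd
        omega
      rw [treeDegree_branchTree hp hne hlt, children_code hl, Finset.card_map, hcard _ _ hus _ hu]

end TannerCode

namespace TannerCode

variable {V J : Type*} (C : TannerCode V J)

/-! ### Cheapest trees -/

section Cheapest

open Classical in
/-- The average cost `c` of the cheapest `m` children of a local-code node `j` reached from `v`,
among the variable nodes in `s`. -/
noncomputable def codeCost (s : Finset V) (m : ℕ) (c : V → ℝ) (v : V) (j : J) : ℝ :=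
  (m : ℝ)⁻¹ * ∑ u ∈ pick ((C.codeNbrs j ∩ s).erase v) m c, c u

variable [Fintype J]

open Classical in
/-- The normalized cost of the cheapest subtree below a variable node `u` at depth `2 (h - k)`
reached from `j`. -/
noncomputable def varCost {h : ℕ} (ω : Fin h → ℝ) (lam : V → ℝ) (s : Finset V) (m : ℕ) :
    ℕ → J → V → ℝ
  | 0 => fun _ u => coord ω h * (lam u / C.varDegree u)
  | k + 1 => fun j u => coord ω (h - (k + 1)) * (lam u / C.varDegree u) +
      ((C.varDegree u : ℝ) - 1)⁻¹ *
        ∑ j' ∈ (C.varNbrs u).erase j, C.codeCost s m (varCost ω lam s m k j') u j'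

open Classical in
/-- The cheapest children of local-code nodes. -/
noncomputable def cheapChildren {h : ℕ} (ω : Fin h → ℝ) (lam : V → ℝ) (s : Finset V) (m : ℕ)
    (n : ℕ) (v : V) (j : J) : Finset V :=
  pick ((C.codeNbrs j ∩ s).erase v) m (C.varCost ω lam s m (h - 1 - n / 2) j)

/-- The normalized cost of the part of the cheapest tree rooted at `r` that lies below `p`. -/
noncomputable def costToGo {h : ℕ} (ω : Fin h → ℝ) (lam : V → ℝ) (s : Finset V) (m : ℕ) (r : V)
    (p : List (V ⊕ J)) : ℝ :=
  match (Sum.inl r :: p).reverse with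
  | Sum.inl u :: Sum.inr j :: _ => C.varCost ω lam s m (h - p.length / 2) j u
  | Sum.inr j :: Sum.inl v :: _ =>
      C.codeCost s m (C.varCost ω lam s m (h - 1 - p.length / 2) j) v j
  | _ => 0

/-- The cost of the single vertex `p`, up to the product of degrees. -/
noncomputable def vertexCost {h : ℕ} (ω : Fin h → ℝ) (lam : V → ℝ) (r : V)
    (p : List (V ⊕ J)) : ℝ :=
  coord ω ((p.length + 1) / 2) *
    Sum.elim (fun v => lam v / C.varDegree v) (fun _ => 0) (endpoint (Sum.inl r) p)

variable {C} {h : ℕ} {ω : Fin h → ℝ} {lam : V → ℝ} {s : Finset V} {m : ℕ} {r : V}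
  {p l : List (V ⊕ J)}

theorem costToGo_var {j : J} {u : V} (hl : Sum.inl r :: p = l ++ [Sum.inr j, Sum.inl u]) :
    C.costToGo ω lam s m r p = C.varCost ω lam s m (h - p.length / 2) j u := by
  simp [costToGo, hl]

theorem costToGo_code {j : J} {v : V} (hl : Sum.inl r :: p = l ++ [Sum.inl v, Sum.inr j]) :
    C.costToGo ω lam s m r p =
      C.codeCost s m (C.varCost ω lam s m (h - 1 - p.length / 2) j) v j := by
  simp [costToGo, hl]

open Classical in
theorem cheapChildren_subset (n : ℕ) (v : V) (j : J) :
    C.cheapChildren ω lam s m n v j ⊆ (C.codeNbrs j ∩ s).erase v :=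
  pick_subset _ _ _

open Classical in
theorem card_cheapChildren
    (hcard : ∀ v ∈ s, ∀ j, v ∈ C.codeNbrs j → m + 1 ≤ (C.codeNbrs j ∩ s).card)
    (n : ℕ) {v : V} (hv : v ∈ s) {j : J} (hj : v ∈ C.codeNbrs j) :
    (C.cheapChildren ω lam s m n v j).card = m := by
  refine card_pick _ ?_
  rw [Finset.card_erase_of_mem (Finset.mem_inter.2 ⟨hj, hv⟩)]
  have := hcard v hv j hj
  omega

open Classical in
-- Dynamic programming: `costToGo` satisfies the recursion of `sum_branchTree`, with a variable node
-- paying its own cost and a local-code node paying nothing.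
theorem sum_vertexCost_eq
    (hcard : ∀ v ∈ s, ∀ j, v ∈ C.codeNbrs j → m + 1 ≤ (C.codeNbrs j ∩ s).card)
    (hh : 1 ≤ h) (hr : r ∈ s) :
    ∑ p ∈ (branchTree (C.children (C.cheapChildren ω lam s m) r) (2 * h)).filter
        (fun p => p ≠ []),
      C.vertexCost ω lam r p * branchWeight (C.children (C.cheapChildren ω lam s m) r) p =
      ∑ j ∈ C.varNbrs r, C.codeCost s m (C.varCost ω lam s m (h - 1) j) r j := by
  rw [sum_branchTree (by omega) (C.vertexCost ω lam r) (C.costToGo ω lam s m r), children_nil,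
    Finset.sum_map]
  · refine Finset.sum_congr rfl fun j _ => ?_
    rw [costToGo_code (l := []) (v := r) (j := j) (by simp)]
    simp
  · intro n hn hnH p hp
    have hlen := length_of_mem_level hp
    obtain ⟨-, ⟨-, h0⟩ | ⟨l, j, u, hl, hu, hus, hev, -⟩ | ⟨l, v, j, hl, hv, hvs, hodd⟩⟩ :=
      mem_level_children cheapChildren_subset hr hp
    · omega
    · obtain ⟨t, rfl⟩ := hev
      obtain ⟨k, hk⟩ : ∃ k, h - t = k + 1 := ⟨h - t - 1, by omega⟩
      have e1 : h - p.length / 2 = k + 1 := by omega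
      have e2 : h - (k + 1) = t := by omega
      have e3 : (p.length + 1) / 2 = t := by omega
      have hcu : (((C.varNbrs u).erase j).card : ℝ) = (C.varDegree u : ℝ) - 1 := by
        have hj : j ∈ C.varNbrs u := mem_varNbrs.2 hu
        rw [Finset.card_erase_of_mem hj, Nat.cast_sub (Finset.card_pos.2 ⟨j, hj⟩),
          varDegree_eq_card, Nat.cast_one]
      rw [costToGo_var hl, e1, children_var hl, Finset.sum_map, Finset.card_map, hcu, varCost,
        vertexCost, endpoint_eq hl, e2, e3]
      simp only [Sum.elim_inl]
      congr 2
      refine Finset.sum_congr rfl fun j' _ => ?_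
      have hl' : Sum.inl r :: (p ++ [Sum.inr j']) =
          (l ++ [Sum.inr j]) ++ [Sum.inl u, Sum.inr j'] := by
        rw [← List.cons_append, hl]
        simp
      have e4 : h - 1 - (p ++ [Sum.inr j']).length / 2 = k := by
        rw [List.length_append, List.length_singleton]
        omega
      rw [Function.Embedding.inr_apply, costToGo_code hl', e4]
    · obtain ⟨t, rfl⟩ := hodd
      rw [costToGo_code hl, children_code hl, Finset.sum_map, Finset.card_map,
        card_cheapChildren hcard _ hvs hv, vertexCost, endpoint_eq hl]
      simp only [Sum.elim_inr, mul_zero, zero_add]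
      rw [codeCost]
      congr 1
      refine Finset.sum_congr rfl fun u _ => ?_
      have hl' : Sum.inl r :: (p ++ [Sum.inl u]) =
          (l ++ [Sum.inl v]) ++ [Sum.inr j, Sum.inl u] := by
        rw [← List.cons_append, hl]
        simp
      have e4 : h - (p ++ [(Sum.inl u : V ⊕ J)]).length / 2 = h - 1 - p.length / 2 := by
        rw [List.length_append, List.length_singleton]
        omega
      rw [Function.Embedding.inl_apply, costToGo_var hl', e4]
  · intro p hp
    have hlen := length_of_mem_level hp
    obtain ⟨-, ⟨-, h0⟩ | ⟨l, j, u, hl, hu, hus, hev, -⟩ | ⟨l, v, j, hl, hv, hvs, hodd⟩⟩ :=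
      mem_level_children cheapChildren_subset hr hp
    · omega
    · have e1 : h - p.length / 2 = 0 := by omega
      have e2 : (p.length + 1) / 2 = h := by omega
      rw [costToGo_var hl, e1, varCost, vertexCost, endpoint_eq hl, e2, Sum.elim_inl]
    · obtain ⟨t, ht⟩ := hodd
      omega

variable [Fintype V]

open Classical in
-- Exchanging the sums over `v` and over tree vertices leaves one term per vertex, since each path
-- has a single endpoint.
theorem dotProduct_projection_branchTree (S : ℕ → V → J → Finset V) :
    lam ⬝ᵥ C.projection ω (Sum.inl r) (branchTree (C.children S r) (2 * h)) =
      ∑ p ∈ (branchTree (C.children S r) (2 * h)).filter (fun p => p ≠ []),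
        C.vertexCost ω lam r p * branchWeight (C.children S r) p := by
  set T := branchTree (C.children S r) (2 * h) with hT
  have hw : ∀ p ∈ T, ∀ v, C.treeWeight ω T v p =
      coord ω ((p.length + 1) / 2) / (C.varDegree v : ℝ) * branchWeight (C.children S r) p := by
    intro p hp v
    rw [treeWeight, branchWeight]
    congr 1
    refine Finset.prod_congr rfl fun k hk => ?_
    rw [Finset.mem_Ico] at hk
    have hlen : (p.take k).length = k := by
      rw [List.length_take]
      omega
    have hpl := (mem_branchTree.1 hp).1
    rw [hT, treeDegree_branchTree (prefix_mem_branchTree hp (List.take_prefix k p))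
      (List.length_pos_iff.1 (by omega)) (by omega)]
    simp
  calc lam ⬝ᵥ C.projection ω (Sum.inl r) T
      = ∑ v, ∑ p ∈ T.filter (fun p => p ≠ []),
          if endpoint (Sum.inl r) p = Sum.inl v then lam v * C.treeWeight ω T v p else 0 := by
        refine Finset.sum_congr rfl fun v _ => ?_
        rw [projection, Finset.mul_sum, ← Finset.sum_filter, Finset.filter_filter]
    _ = ∑ p ∈ T.filter (fun p => p ≠ []), ∑ v,
          if endpoint (Sum.inl r) p = Sum.inl v then lam v * C.treeWeight ω T v p else 0 :=
        Finset.sum_comm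
    _ = _ := by
        refine Finset.sum_congr rfl fun p hp => ?_
        have hpT := (Finset.mem_filter.1 hp).1
        rw [vertexCost]
        rcases endpoint (Sum.inl r) p with u | j
        · simp only [Sum.inl.injEq, Finset.sum_ite_eq, Finset.mem_univ, if_true, Sum.elim_inl]
          rw [hw p hpT]
          ring
        · simp

open Classical in
/-- The cheapest tree rooted at `r` gives a deviation whose cost is known. -/
theorem exists_deviation_dotProduct_eq
    (hcard : ∀ v ∈ s, ∀ j, v ∈ C.codeNbrs j → m + 1 ≤ (C.codeNbrs j ∩ s).card)
    (hh : 1 ≤ h) (hr : r ∈ s) :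
    ∃ β ∈ C.deviations ω (m + 1), lam ⬝ᵥ β =
      ∑ j ∈ C.varNbrs r, C.codeCost s m (C.varCost ω lam s m (h - 1) j) r j :=
  ⟨_, ⟨r, _, isDTree_branchTree cheapChildren_subset
      (fun n _ hv _ hj => by rw [card_cheapChildren hcard n hv hj]) hr, rfl⟩,
    (dotProduct_projection_branchTree _).trans (sum_vertexCost_eq hcard hh hr)⟩

theorem sum_edges_comm (F : V → J → ℝ) :
    ∑ j, ∑ u ∈ C.codeNbrs j, F u j = ∑ u, ∑ j ∈ C.varNbrs u, F u j :=
  Finset.sum_comm' (by simp)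

open Classical in
/-- The total cost of the cheapest subtrees, weighted by `f`, is at most that of `f` itself. -/
theorem sum_varCost_le {f : V → ℝ} (hdeg : ∀ v, 2 ≤ C.varDegree v)
    (hf : ∀ j, ∀ c : V → ℝ, ∑ u ∈ C.codeNbrs j, f u * C.codeCost s m c u j ≤
      ∑ u ∈ C.codeNbrs j, f u * c u) (k : ℕ) (hk : k < h) :
    ∑ j, ∑ u ∈ C.codeNbrs j, f u * C.varCost ω lam s m k j u ≤
      (∑ t ∈ Finset.Icc (h - k) h, coord ω t) * ∑ u, lam u * f u := by
  -- Each `u` is counted once per neighboring local code, which cancels the division by its degree.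
  have hself : ∀ a : ℝ, ∑ j, ∑ u ∈ C.codeNbrs j, f u * (a * (lam u / C.varDegree u)) =
      a * ∑ u, lam u * f u := by
    intro a
    rw [sum_edges_comm fun u _ => f u * (a * (lam u / C.varDegree u)), Finset.mul_sum]
    refine Finset.sum_congr rfl fun u _ => ?_
    have : (C.varDegree u : ℝ) ≠ 0 := by
      have := hdeg u
      exact_mod_cast (by omega : C.varDegree u ≠ 0)
    rw [Finset.sum_const, nsmul_eq_mul, ← varDegree_eq_card]
    field_simp
  induction k with
  | zero =>
    simp only [varCost]
    rw [hself]
    simp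
  | succ k ih =>
    have hIcc : ∑ t ∈ Finset.Icc (h - (k + 1)) h, coord ω t =
        coord ω (h - (k + 1)) + ∑ t ∈ Finset.Icc (h - k) h, coord ω t := by
      have e : h - k = h - (k + 1) + 1 := by omega
      rw [e, ← Finset.add_sum_Ioc_eq_sum_Icc (by omega : h - (k + 1) ≤ h)]
      congr 2
      ext t
      simp only [Finset.mem_Ioc, Finset.mem_Icc]
      omega
    simp only [varCost, mul_add, Finset.sum_add_distrib]
    rw [hself, hIcc, add_mul]
    -- Own costs match exactly. The children's costs are regrouped by the local codes below, where
    -- `hf` removes one level of the tree.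
    refine add_le_add le_rfl (le_trans (le_of_eq ?_)
      ((Finset.sum_le_sum fun j _ => hf j (C.varCost ω lam s m k j)).trans (ih (by omega))))
    rw [sum_edges_comm fun u j => f u * C.codeCost s m (C.varCost ω lam s m k j) u j,
      sum_edges_comm fun u j => f u * (((C.varDegree u : ℝ) - 1)⁻¹ * _)]
    refine Finset.sum_congr rfl fun u _ => ?_
    have hd : ((C.varDegree u : ℝ) - 1) ≠ 0 := by
      have : (2 : ℝ) ≤ C.varDegree u := by exact_mod_cast hdeg u
      linarith
    rw [← Finset.mul_sum, ← Finset.mul_sum, ← Finset.mul_sum]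
    congr 1
    rw [inv_mul_eq_iff_eq_mul₀ hd]
    -- Summed over the parents `j`, each child `j'` appears `deg u - 1` times.
    have he : ∀ j ∈ C.varNbrs u, ∑ j' ∈ (C.varNbrs u).erase j,
        C.codeCost s m (C.varCost ω lam s m k j') u j' =
        ∑ j' ∈ C.varNbrs u, C.codeCost s m (C.varCost ω lam s m k j') u j' -
          C.codeCost s m (C.varCost ω lam s m k j) u j := fun j hj => by
      rw [← Finset.add_sum_erase _ _ hj, add_sub_cancel_left]
    rw [Finset.sum_congr rfl he, Finset.sum_sub_distrib, Finset.sum_const, nsmul_eq_mul,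
      ← varDegree_eq_card]
    ring

/-- The root has no parent: all its local codes are children and no factor `1 / (deg - 1)` arises,
so a single use of `hf` reduces to `sum_varCost_le`. -/
theorem sum_root_cost_le {f : V → ℝ} (hdeg : ∀ v, 2 ≤ C.varDegree v)
    (hf : ∀ j, ∀ c : V → ℝ, ∑ u ∈ C.codeNbrs j, f u * C.codeCost s m c u j ≤
      ∑ u ∈ C.codeNbrs j, f u * c u) (hh : 1 ≤ h) :
    ∑ r, f r * ∑ j ∈ C.varNbrs r, C.codeCost s m (C.varCost ω lam s m (h - 1) j) r j ≤
      (∑ t ∈ Finset.Icc 1 h, coord ω t) * ∑ u, lam u * f u := by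
  simp only [Finset.mul_sum (C.varNbrs _)]
  rw [← sum_edges_comm fun u j => f u * C.codeCost s m (C.varCost ω lam s m (h - 1) j) u j]
  refine (Finset.sum_le_sum fun j _ => hf j _).trans ?_
  have := sum_varCost_le (ω := ω) (lam := lam) hdeg hf (h - 1) (by omega)
  rwa [show h - (h - 1) = 1 by omega] at this

end Cheapest

end TannerCode

/-! ### Relative points -/

section Relative

variable {V : Type*}

theorem toReal_of_eq_zero {x : V → ZMod 2} {v : V} (h : x v = 0) : toReal x v = 0 := by
  simp [toReal, h]

theorem toReal_of_eq_one {x : V → ZMod 2} {v : V} (h : x v = 1) : toReal x v = 1 := by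
  simp [toReal, h, ZMod.val_one]

theorem eq_zero_or_eq_one (a : ZMod 2) : a = 0 ∨ a = 1 := by
  revert a
  decide

theorem toReal_eq_zero_or_eq_one (x : V → ZMod 2) (v : V) : toReal x v = 0 ∨ toReal x v = 1 :=
  (eq_zero_or_eq_one (x v)).imp toReal_of_eq_zero toReal_of_eq_one

theorem toReal_mem_Icc (x : V → ZMod 2) (v : V) : toReal x v ∈ Set.Icc (0 : ℝ) 1 := by
  rcases toReal_eq_zero_or_eq_one x v with h | h <;> simp [h]

theorem relativePoint_toReal (x : V → ZMod 2) {f : V → ℝ} {v : V}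
    (hf : f v ∈ Set.Icc (0 : ℝ) 1) :
    relativePoint (toReal x) f v = toReal x v + (1 - 2 * toReal x v) * f v := by
  rw [relativePoint]
  rcases toReal_eq_zero_or_eq_one x v with h | h <;> rw [h]
  · rw [zero_sub, abs_neg, abs_of_nonneg hf.1]
    ring
  · rw [abs_of_nonneg (by linarith [hf.2])]
    ring

open Classical in
-- On the unit cube `|x - ·|` is affine, hence commutes with convex combinations, and it sends a
-- word to the indicator of where it differs from `x`.
theorem relativePoint_sum {κ : Type*} [Fintype κ] (x : V → ZMod 2) (a : κ → V → ZMod 2)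
    (w : κ → ℝ) (hw : ∀ k, 0 ≤ w k) (hw1 : ∑ k, w k = 1) (v : V) :
    relativePoint (toReal x) (∑ k, w k • toReal (a k)) v =
      ∑ k, if a k v ≠ x v then w k else 0 := by
  have hz : (∑ k, w k • toReal (a k)) v = ∑ k, w k * toReal (a k) v := by
    simp [Finset.sum_apply]
  have hmem : (∑ k, w k • toReal (a k)) v ∈ Set.Icc (0 : ℝ) 1 := by
    rw [hz]
    refine ⟨Finset.sum_nonneg fun k _ => mul_nonneg (hw k) (toReal_mem_Icc _ _).1, ?_⟩
    rw [← hw1]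
    exact Finset.sum_le_sum fun k _ => mul_le_of_le_one_right (hw k) (toReal_mem_Icc _ _).2
  rw [relativePoint_toReal x hmem, hz]
  calc toReal x v + (1 - 2 * toReal x v) * ∑ k, w k * toReal (a k) v
      = ∑ k, w k * (toReal x v + (1 - 2 * toReal x v) * toReal (a k) v) := by
        simp only [mul_add, Finset.sum_add_distrib]
        rw [← Finset.sum_mul, hw1, one_mul, Finset.mul_sum]
        congr 1
        exact Finset.sum_congr rfl fun k _ => by ring
    _ = _ := by
        refine Finset.sum_congr rfl fun k _ => ?_
        rcases eq_zero_or_eq_one (x v) with hx | hx <;>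
          rcases eq_zero_or_eq_one (a k v) with ha | ha <;>
          simp only [hx, ha, toReal_of_eq_zero, toReal_of_eq_one] <;> norm_num

theorem dotProduct_relativePoint [Fintype V] (lam : V → ℝ) (x : V → ZMod 2) {f : V → ℝ}
    (hf : ∀ v, f v ∈ Set.Icc (0 : ℝ) 1) :
    lam ⬝ᵥ relativePoint (toReal x) f =
      lam ⬝ᵥ toReal x + (fun v => lam v * (1 - 2 * toReal x v)) ⬝ᵥ f := by
  simp only [dotProduct, ← Finset.sum_add_distrib]
  refine Finset.sum_congr rfl fun v _ => ?_
  rw [relativePoint_toReal x (hf v)]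
  ring

/-- On the unit cube `|x - ·|` is an involution for a binary `x`. -/
theorem dotProduct_eq_add_relativePoint [Fintype V] (lam : V → ℝ) (x : V → ZMod 2) {z : V → ℝ}
    (hz : ∀ v, z v ∈ Set.Icc (0 : ℝ) 1) :
    lam ⬝ᵥ z = lam ⬝ᵥ toReal x +
      (fun v => lam v * (1 - 2 * toReal x v)) ⬝ᵥ relativePoint (toReal x) z := by
  simp only [dotProduct, ← Finset.sum_add_distrib]
  refine Finset.sum_congr rfl fun v _ => ?_
  rw [relativePoint_toReal x (hz v)]
  rcases toReal_eq_zero_or_eq_one x v with h | h <;> rw [h] <;> ring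

end Relative

/-! ### Bounds on the level weights -/

theorem coord_mem_Icc {h : ℕ} {ω : Fin h → ℝ} {b : ℝ} (hb : 0 ≤ b)
    (hω : ∀ t, ω t ∈ Set.Icc 0 b) (t : ℕ) : coord ω t ∈ Set.Icc 0 b := by
  rw [coord]
  split_ifs
  · exact hω _
  · exact ⟨le_rfl, hb⟩

theorem sum_coord_pos {h : ℕ} {ω : Fin h → ℝ} (hω : ∀ t, 0 ≤ ω t) (hne : ω ≠ 0) :
    0 < ∑ t ∈ Finset.Icc 1 h, coord ω t := by
  obtain ⟨t, ht⟩ := Function.ne_iff.1 hne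
  have hcoord : coord ω (t + 1) = ω t := by
    rw [coord, dif_pos ⟨by omega, by omega⟩]
    rfl
  refine Finset.sum_pos' (fun t _ => ?_) ⟨t + 1, Finset.mem_Icc.2 ⟨by omega, by omega⟩, ?_⟩
  · rw [coord]
    split_ifs
    · exact hω _
    · exact le_rfl
  · rw [hcoord]
    exact (hω t).lt_of_ne' ht

/-! ### Convex hulls of local codes, seen from a codeword -/

namespace TannerCode

variable {V J : Type*} {C : TannerCode V J}

theorem le_hammingDist_of_le_minDist {n i : ℕ} {D : Submodule (ZMod 2) (Fin n → ZMod 2)}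
    (hi : (i : ℕ∞) ≤ minDist D) {c c' : Fin n → ZMod 2} (hc : c ∈ D) (hc' : c' ∈ D)
    (hne : c ≠ c') : i ≤ hammingDist c c' := by
  have : minDist D ≤ (hammingDist c c' : ℕ∞) :=
    iInf₂_le_of_le c hc (iInf₂_le_of_le c' hc' (iInf_le _ hne))
  exact_mod_cast hi.trans this

open Classical in
/-- Two words of an extended code that differ at some neighbor of `j` differ at many. -/
theorem card_filter_ne {j : J} {i : ℕ} (hi : (i : ℕ∞) ≤ minDist (C.localCode j))
    {a x : V → ZMod 2} (ha : a ∈ C.extendedCode j) (hx : x ∈ C.extendedCode j) :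
    (C.codeNbrs j).filter (fun v => a v ≠ x v) = ∅ ∨
      i ≤ ((C.codeNbrs j).filter (fun v => a v ≠ x v)).card := by
  have hcard : ((C.codeNbrs j).filter (fun v => a v ≠ x v)).card =
      hammingDist (fun k => a (C.nbr j k)) (fun k => x (C.nbr j k)) := by
    rw [codeNbrs, Finset.filter_map, Finset.card_map, hammingDist]
    congr
  by_cases h : (fun k => a (C.nbr j k)) = fun k => x (C.nbr j k)
  · left
    rw [← Finset.card_eq_zero, hcard, h, hammingDist_self]
  · right
    rw [hcard]
    exact le_hammingDist_of_le_minDist hi ha hx h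

theorem mem_Icc_of_mem_convexHull {j : J} {z : V → ℝ}
    (hz : z ∈ convexHull ℝ (toReal '' C.extendedCode j)) (v : V) : z v ∈ Set.Icc (0 : ℝ) 1 := by
  have hsub : toReal '' C.extendedCode j ⊆ Set.Icc (0 : V → ℝ) 1 := by
    rintro - ⟨a, -, rfl⟩
    exact ⟨fun v => (toReal_mem_Icc a v).1, fun v => (toReal_mem_Icc a v).2⟩
  have := convexHull_min hsub (convex_Icc (0 : V → ℝ) 1) hz
  exact ⟨this.1 v, this.2 v⟩

open Classical in
/-- A point of the convex hull of an extended code, seen from a word of that code, is around `j` a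
convex combination of indicators of sets that are empty or have more than `m` elements. -/
theorem codeCost_le_of_mem_convexHull {j : J} {m : ℕ} (hm : 0 < m)
    (hi : ((m + 1 : ℕ) : ℕ∞) ≤ minDist (C.localCode j)) {x : V → ZMod 2}
    (hx : x ∈ C.extendedCode j) {z : V → ℝ}
    (hz : z ∈ convexHull ℝ (toReal '' C.extendedCode j)) {s : Finset V}
    (hs : ∀ v, v ∈ s ↔ relativePoint (toReal x) z v ≠ 0) :
    (∀ c : V → ℝ, ∑ u ∈ C.codeNbrs j, relativePoint (toReal x) z u * C.codeCost s m c u j ≤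
      ∑ u ∈ C.codeNbrs j, relativePoint (toReal x) z u * c u) ∧
    ∀ v ∈ s, v ∈ C.codeNbrs j → m + 1 ≤ (C.codeNbrs j ∩ s).card := by
  rw [mem_convexHull_iff_exists_fintype] at hz
  obtain ⟨κ, _, w, y, hw, hw1, hy, rfl⟩ := hz
  choose a ha hay using hy
  obtain rfl : (fun k => toReal (a k)) = y := funext hay
  set b : κ → Finset V := fun k => (C.codeNbrs j).filter (fun v => a k v ≠ x v) with hb
  have hf : ∀ v ∈ C.codeNbrs j, relativePoint (toReal x) (∑ k, w k • toReal (a k)) v =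
      ∑ k, if v ∈ b k then w k else 0 := by
    intro v hv
    rw [relativePoint_sum x a w hw hw1]
    simp [hb, hv]
  have hbN : ∀ k, b k ⊆ C.codeNbrs j := fun k => Finset.filter_subset _ _
  have hcard : ∀ k, b k = ∅ ∨ m + 1 ≤ (b k).card := fun k => card_filter_ne hi (ha k) hx
  have hbs : ∀ k, w k ≠ 0 → b k ⊆ s := by
    intro k hk v hv
    rw [hs, hf v (hbN k hv)]
    -- The terms are nonnegative, so the positive weight of the `k`-th word cannot cancel.
    refine (Finset.sum_pos' (fun k _ => ?_) ⟨k, Finset.mem_univ k, ?_⟩).ne'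
    · split_ifs
      exacts [hw k, le_rfl]
    · rw [if_pos hv]
      exact (hw k).lt_of_ne' hk
  refine ⟨sum_mul_average_pick_le hm w b _ hw hbN hbs hcard hf, ?_⟩
  intro v hv hvj
  rw [hs, hf v hvj] at hv
  obtain ⟨k, -, hk⟩ := Finset.exists_ne_zero_of_sum_ne_zero hv
  have hvk : v ∈ b k := by
    by_contra h
    simp [h] at hk
  rw [if_pos hvk] at hk
  rcases hcard k with h0 | h0
  · simp [h0] at hvk
  · exact h0.trans (Finset.card_le_card (Finset.subset_inter (hbN k) (hbs k hk)))

/-! ### The size of deviations -/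

/-- An inner vertex of a path has a predecessor and a successor on it. Hence the factors `1 /
(degree - 1)` are at most one. -/
theorem two_le_treeDegree {α : Type*} {G : SimpleGraph α} {r : α} {H : ℕ} {T : Finset (List α)}
    (hT : IsRootedSubtree G r H T) {p : List α} (hp : p ∈ T) {k : ℕ} (hk : 1 ≤ k)
    (hkp : k < p.length) : 2 ≤ treeDegree T (p.take k) := by
  classical
  have hmem : ∀ n, p.take n ∈ T := fun n => hT.2.2 p hp _ (List.take_prefix n p)
  have hlen : ∀ n ≤ p.length, (p.take n).length = n := fun n hn => by
    rw [List.length_take]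
    omega
  have hne : p.take (k - 1) ≠ p.take (k + 1) := by
    intro h
    have := congrArg List.length h
    rw [hlen _ (by omega), hlen _ (by omega)] at this
    omega
  rw [← Finset.card_pair hne, treeDegree]
  refine Finset.card_le_card fun q hq => ?_
  rw [Finset.mem_insert, Finset.mem_singleton] at hq
  rw [Finset.mem_filter]
  rcases hq with rfl | rfl
  · refine ⟨hmem _, Or.inr ⟨List.take_prefix_take_left (by omega), ?_⟩⟩
    rw [hlen _ (by omega), hlen _ (by omega)]
    omega
  · refine ⟨hmem _, Or.inl ⟨List.take_prefix_take_left (by omega), ?_⟩⟩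
    rw [hlen _ (by omega), hlen _ (by omega)]

theorem treeWeight_mem_Icc {h H : ℕ} {ω : Fin h → ℝ} {b : ℝ} (hb : 0 ≤ b)
    (hω : ∀ t, ω t ∈ Set.Icc 0 b) {r : V ⊕ J} {T : Finset (List (V ⊕ J))}
    (hT : IsRootedSubtree C.graph r H T) (v : V) {p : List (V ⊕ J)} (hp : p ∈ T) :
    C.treeWeight ω T v p ∈ Set.Icc 0 b := by
  have hc := coord_mem_Icc hb hω ((p.length + 1) / 2)
  have hfac : ∀ k ∈ Finset.Ico 1 p.length,
      1 / ((treeDegree T (p.take k) : ℝ) - 1) ∈ Set.Icc (0 : ℝ) 1 := by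
    intro k hk
    rw [Finset.mem_Ico] at hk
    have : (2 : ℝ) ≤ treeDegree T (p.take k) := by
      exact_mod_cast two_le_treeDegree hT hp hk.1 hk.2
    refine ⟨one_div_nonneg.2 (by linarith), ?_⟩
    rw [div_le_one (by linarith)]
    linarith
  have hprod0 := Finset.prod_nonneg fun k hk => (hfac k hk).1
  have hprod1 := Finset.prod_le_one (fun k hk => (hfac k hk).1) fun k hk => (hfac k hk).2
  have hdiv0 : 0 ≤ coord ω ((p.length + 1) / 2) / (C.varDegree v : ℝ) :=
    div_nonneg hc.1 (Nat.cast_nonneg _)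
  have hdiv1 : coord ω ((p.length + 1) / 2) / (C.varDegree v : ℝ) ≤ b := by
    rcases Nat.eq_zero_or_pos (C.varDegree v) with h0 | h0
    · simpa [h0] using hb
    · exact (div_le_self hc.1 (by exact_mod_cast h0)).trans hc.2
  exact ⟨mul_nonneg hdiv0 hprod0, (mul_le_of_le_one_right hdiv0 hprod1).trans hdiv1⟩

variable [Fintype V] [Fintype J]

/-- The deviations of small weights are in the unit cube. -/
theorem deviation_mem_Icc {h : ℕ} {ω : Fin h → ℝ} {M : ℕ}
    (hM : {p : List (V ⊕ J) | p.length ≤ 2 * h}.ncard ≤ M)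
    (hω : ∀ t, ω t ∈ Set.Icc (0 : ℝ) (1 / M)) {i : ℕ} {β : V → ℝ} (hβ : β ∈ C.deviations ω i)
    (v : V) : β v ∈ Set.Icc (0 : ℝ) 1 := by
  classical
  obtain ⟨r, T, ⟨hT, -⟩, rfl⟩ := hβ
  have hb : (0 : ℝ) ≤ 1 / M := by positivity
  have hw := fun p hp => treeWeight_mem_Icc hb hω hT v (p := p) hp
  refine ⟨Finset.sum_nonneg fun p hp => (hw p (Finset.mem_of_mem_filter p hp)).1, ?_⟩
  have hcard : T.card ≤ M := by
    rw [← Set.ncard_coe_finset T]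
    exact (Set.ncard_le_ncard (fun p hp => (hT.1 hp).2)
      (List.finite_length_le (V ⊕ J) (2 * h))).trans hM
  have hcard' : ((T.filter fun p => p ≠ [] ∧ endpoint (Sum.inl r) p = Sum.inl v).card : ℝ) ≤ M :=
    by exact_mod_cast (Finset.card_filter_le _ _).trans hcard
  rw [projection]
  refine (Finset.sum_le_card_nsmul _ _ (1 / (M : ℝ))
    fun p hp => (hw p (Finset.mem_of_mem_filter p hp)).2).trans ?_
  rw [nsmul_eq_mul]
  exact (mul_le_mul_of_nonneg_right (by convert hcard') hb).trans
    (by rw [mul_one_div]; exact div_self_le_one _)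

/-! ### Local optimality and LP optimality -/

/-- Local optimality implies unique LP optimality if all deviations are in the unit cube. -/
theorem IsLocallyOptimal.isUniqueLPOptimum (hdeg : ∀ v, C.varDegree v ≠ 1) {h : ℕ}
    {ω : Fin h → ℝ} {i : ℕ} {lam : V → ℝ} {x : V → ZMod 2} (hω : ∀ t, 0 ≤ ω t) (hω0 : ω ≠ 0)
    (hi2 : 2 ≤ i) (hi : (i : ℕ∞) ≤ C.minLocalDist)
    (hβ : ∀ β ∈ C.deviations ω i, ∀ v, β v ∈ Set.Icc (0 : ℝ) 1)
    (hx : C.IsLocallyOptimal ω i lam x) : C.IsUniqueLPOptimum lam (toReal x) := by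
  classical
  obtain ⟨m, rfl⟩ : ∃ m, i = m + 1 := ⟨i - 1, by omega⟩
  obtain ⟨hxC, hopt⟩ := hx
  have hxj : ∀ j, x ∈ C.extendedCode j := Set.mem_iInter.1 hxC
  refine ⟨Set.mem_iInter.2 fun j => subset_convexHull _ _ ⟨x, hxj j, rfl⟩, fun z hz hzx => ?_⟩
  have hzj := Set.mem_iInter.1 hz
  have hh : 1 ≤ h := by
    rcases Nat.eq_zero_or_pos h with rfl | hpos
    · exact absurd (Subsingleton.elim ω 0) hω0
    · exact hpos
  set lam' : V → ℝ := fun v => lam v * (1 - 2 * toReal x v) with hlam'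
  have hpos : ∀ β ∈ C.deviations ω (m + 1), 0 < lam' ⬝ᵥ β := by
    intro β hmem
    have := hopt β hmem
    rw [dotProduct_relativePoint lam x (hβ β hmem)] at this
    linarith
  have hdeg2 : ∀ v, 2 ≤ C.varDegree v := by
    intro v
    by_contra hlt
    have h0 : C.varNbrs v = ∅ := by
      rw [← Finset.card_eq_zero, ← varDegree_eq_card]
      have := hdeg v
      omega
    -- At an isolated node the tree is the root alone; its deviation has cost zero, against local
    -- optimality.
    obtain ⟨β, hmem, heq⟩ := exists_deviation_dotProduct_eq (C := C) (ω := ω) (lam := lam')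
      (s := {v}) (m := m) (r := v) (fun u hu j hj => by
        rw [Finset.mem_singleton.1 hu, ← mem_varNbrs, h0] at hj
        simp at hj) hh (by simp)
    have := hpos β hmem
    rw [heq, h0, Finset.sum_empty] at this
    exact lt_irrefl _ this
  have hzIcc : ∀ v, z v ∈ Set.Icc (0 : ℝ) 1 := by
    intro v
    -- Some local code must exist, since an empty intersection of hulls would not bound `z`.
    have : 0 < (C.varNbrs v).card := by
      rw [← varDegree_eq_card]
      have := hdeg2 v
      omega
    obtain ⟨j, -⟩ := Finset.card_pos.1 this
    exact mem_Icc_of_mem_convexHull (hzj j) v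
  set f : V → ℝ := relativePoint (toReal x) z with hf
  set s : Finset V := Finset.univ.filter (fun v => f v ≠ 0) with hs
  have hlocal := fun j => codeCost_le_of_mem_convexHull (C := C) (j := j) (by omega : 0 < m)
    (hi.trans (iInf_le _ j)) (hxj j) (hzj j) (s := s) (by simp [hs, hf])
  have hle := sum_root_cost_le (ω := ω) (lam := lam') hdeg2 (fun j => (hlocal j).1) hh
  have hcost : ∀ r, f r ≠ 0 →
      0 < ∑ j ∈ C.varNbrs r, C.codeCost s m (C.varCost ω lam' s m (h - 1) j) r j := by
    intro r hr
    obtain ⟨β, hmem, heq⟩ := exists_deviation_dotProduct_eq (C := C) (ω := ω) (lam := lam')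
      (s := s) (m := m) (r := r) (fun v hv j hj => (hlocal j).2 v hv hj) hh (by simp [hs, hr])
    rw [← heq]
    exact hpos β hmem
  have hf0 : ∀ v, 0 ≤ f v := fun v => abs_nonneg _
  obtain ⟨v, hv⟩ := Function.ne_iff.1 hzx
  have hfv : f v ≠ 0 := fun h0 => hv (sub_eq_zero.1 (abs_eq_zero.1 h0)).symm
  have hsum : 0 < ∑ r, f r *
      ∑ j ∈ C.varNbrs r, C.codeCost s m (C.varCost ω lam' s m (h - 1) j) r j := by
    refine Finset.sum_pos' (fun r _ => ?_) ⟨v, Finset.mem_univ v,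
      mul_pos ((hf0 v).lt_of_ne' hfv) (hcost v hfv)⟩
    by_cases h0 : f r = 0
    · simp [h0]
    · exact mul_nonneg (hf0 r) (hcost r h0).le
  have hfin : 0 < lam' ⬝ᵥ f :=
    pos_of_mul_pos_right (hsum.trans_le hle) (sum_coord_pos hω hω0).le
  rw [dotProduct_eq_add_relativePoint lam x hzIcc]
  linarith

end TannerCode

end Tanner

theorem theorem2 {V J : Type*} [Fintype V] [Fintype J] (C : Tanner.TannerCode V J)
    (hdeg : ∀ v, C.varDegree v ≠ 1) :
    (∃ M : ℕ, 0 < M ∧ ∀ (h : ℕ) (ω : Fin h → ℝ) (i : ℕ) (lam : V → ℝ) (x : V → ZMod 2),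
      (∀ t, ω t ∈ Set.Icc (0 : ℝ) (1 / M)) → ω ≠ 0 →
      2 ≤ i → (i : ℕ∞) ≤ C.minLocalDist →
      (∀ β ∈ C.deviations ω i, ∀ v, β v ∈ Set.Icc (0 : ℝ) 1) →
      C.IsLocallyOptimal ω i lam x →
      C.IsUniqueLPOptimum lam (Tanner.toReal x)) ∧
    (∀ h : ℕ, ∃ M : ℕ, 0 < M ∧
      ∀ (ω : Fin h → ℝ) (i : ℕ) (lam : V → ℝ) (x : V → ZMod 2),
      (∀ t, ω t ∈ Set.Icc (0 : ℝ) (1 / M)) → ω ≠ 0 →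
      2 ≤ i → (i : ℕ∞) ≤ C.minLocalDist →
      C.IsLocallyOptimal ω i lam x →
      C.IsUniqueLPOptimum lam (Tanner.toReal x)) := by
  -- Any positive `M` serves in the first part, where containment in the cube is assumed. In the
  -- second, `M` exceeds the number of vertices of any tree of height `2h`, each of weight at most
  -- `1 / M`.
  refine ⟨⟨1, one_pos, fun h ω i lam x hω hω0 hi2 hi hβ hx =>
    hx.isUniqueLPOptimum hdeg (fun t => (hω t).1) hω0 hi2 hi hβ⟩, fun h => ?_⟩
  refine ⟨{p : List (V ⊕ J) | p.length ≤ 2 * h}.ncard + 1, Nat.succ_pos _,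
    fun ω i lam x hω hω0 hi2 hi hx =>
      hx.isUniqueLPOptimum hdeg (fun t => (hω t).1) hω0 hi2 hi fun β hβ v =>
        Tanner.TannerCode.deviation_mem_Icc (Nat.le_succ _) hω hβ v⟩
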